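/- Let $n$ be a positive integer or $n=\infty$, and let $T=(T_1,\dots,T_n)$ be nonzero bounded operators on a complex Hilbert space $\mathcal H$ with $\sum_{i} T_iT_i^*\le I_{\mathcal H}$. Let $\mathcal P=\{P_k\}_{k\in\mathcal J}$ be a countable family of orthogonal projections on $\mathcal H$ that stabilizes $T$, i.e. $P_kT_i\in\{T_i,0\}$ and $T_iP_k\in\{T_i,0\}$ for all $i,k$, and $\sum_k P_k=I_{\mathcal H}$; assume also that for every $k$ there is an $i$ with $T_iP_k\neq 0$. (Infinite sums of operators converge in the strong operator topology.) A tuple $S=(S_1,\dots,S_n)$ of nonzero bounded operators on a Hilbert space $\mathcal K$ satisfies $(\dagger)$ if 1. $(S_i^*S_i)^2=S_i^*S_i$ for all $i$; 2. $\sum_i S_iS_i^*\le I_{\mathcal K}$; 3. for all $i,j$, either $(S_i^*S_i)(S_j^*S_j)=0$ or $S_i^*S_i=S_j^*S_j$; 4. for every $i$ there is a $j$ with $S_iS_i^*\le S_j^*S_j$; 5. the distinct elements of $\{S_i^*S_i\}$ sum to $I_{\mathcal K}$. If $\mathcal K\supseteq\mathcal H$, such a tuple is a minimal partially isometric dilation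 of $T$ if it satisfies $(\dagger)$; $\mathcal H$ reduces every $S_i^*S_i$; $\mathcal H$ is invariant for every $S_i^*$, with $S_i^*|_{\mathcal H}=T_i^*$; and $\mathcal K$ is the closed linear span of $\mathcal H$ and all subspaces $S_{i_1}\cdots S_{i_m}\mathcal H$, $m\ge 1$. Then there is a minimal partially isometric dilation $S$ of $T$ on some Hilbert space $\mathcal K\supseteq\mathcal H$ with $\mathcal P=\{S_i^*S_i|_{\mathcal H}:1\le i\le n\}$. It is unique up to a joint unitary equivalence that fixes $\mathcal H$: if $S$ on $\mathcal K$ and $S'$ on $\mathcal K'$ are two such dilations, then there is a unitary $U:\mathcal K\to\mathcal K'$ with $U|_{\mathcal H}=I_{\mathcal H}$ and $U^*S_i'U=S_i$ for all $i$. -/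

import Mathlib

universe u v w

/-- `∑ i, A i = B` in the strong operator topology (an ordinary sum if `ι` is finite). -/
def HasStrongSum {ι H : Type*} [NormedAddCommGroup H] [InnerProductSpace ℂ H]
    (A : ι → H →L[ℂ] H) (B : H →L[ℂ] H) : Prop :=
  ∀ x : H, HasSum (fun i => A i x) (B x)

/-- `(T i)` is a row contraction: `∑ i, T i (T i)* ≤ I`. -/
def IsRowContraction {ι H : Type*} [NormedAddCommGroup H] [InnerProductSpace ℂ H]
    [CompleteSpace H] (T : ι → H →L[ℂ] H) : Prop :=
  ∃ R : H →L[ℂ] H, HasStrongSum (fun i => T i * star (T i)) R ∧ R ≤ 1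

/-- The family `P` of orthogonal projections stabilizes `T`:
`P k T i` and `T i P k` lie in `{T i, 0}`, and `∑ k, P k = I`. -/
structure Stabilizes {ι J H : Type*} [NormedAddCommGroup H] [InnerProductSpace ℂ H]
    [CompleteSpace H] (P : J → H →L[ℂ] H) (T : ι → H →L[ℂ] H) : Prop where
  isProj : ∀ k, IsStarProjection (P k)
  left : ∀ k i, P k * T i = T i ∨ P k * T i = 0
  right : ∀ k i, T i * P k = T i ∨ T i * P k = 0
  sum_eq : HasStrongSum P 1

/-- The relations (†) for a tuple of nonzero operators. -/
structure DaggerRelations {ι K : Type*} [NormedAddCommGroup K] [InnerProductSpace ℂ K]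
    [CompleteSpace K] (S : ι → K →L[ℂ] K) : Prop where
  ne_zero : ∀ i, S i ≠ 0
  idem : ∀ i, (star (S i) * S i) ^ 2 = star (S i) * S i
  row : IsRowContraction S
  orth_or_eq : ∀ i j, (star (S i) * S i) * (star (S j) * S j) = 0 ∨
    star (S i) * S i = star (S j) * S j
  final_le : ∀ i, ∃ j, S i * star (S i) ≤ star (S j) * S j
  /-- the distinct elements of `{S i* S i}` sum to the identity -/
  sum_init : HasStrongSum
    (fun Q : Set.range (fun i => star (S i) * S i) => (Q : K →L[ℂ] K)) 1

/-- The subspace `M` reduces `A`: it is invariant for `A` and for `A*`. -/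
def ReducedBy {K : Type*} [NormedAddCommGroup K] [InnerProductSpace ℂ K]
    [CompleteSpace K] (M : Submodule ℂ K) (A : K →L[ℂ] K) : Prop :=
  (∀ x ∈ M, A x ∈ M) ∧ (∀ x ∈ M, star A x ∈ M)

/-- `S` on `K` is a minimal partially isometric dilation of `T` on `H`, where `H` is regarded as
a closed subspace of `K` through the isometric embedding `V`. -/
structure IsMinimalPartiallyIsometricDilation {ι H K : Type*}
    [NormedAddCommGroup H] [InnerProductSpace ℂ H] [CompleteSpace H]
    [NormedAddCommGroup K] [InnerProductSpace ℂ K] [CompleteSpace K]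
    (T : ι → H →L[ℂ] H) (V : H →ₗᵢ[ℂ] K) (S : ι → K →L[ℂ] K) : Prop where
  dagger : DaggerRelations S
  reduces : ∀ i, ReducedBy (LinearMap.range V.toLinearMap) (star (S i) * S i)
  /-- `H` is invariant for `S i*`, and `S i*` restricts to `T i*` on `H` -/
  adjoint_restrict : ∀ i h, star (S i) (V h) = V (star (T i) h)
  /-- `K` is the closed linear span of the `S i₁ ⋯ S iₘ H`, `m ≥ 0` -/
  minimal : (Submodule.span ℂ
    {x : K | ∃ (w : List ι) (h : H), x = (w.map S).prod (V h)}).topologicalClosure = ⊤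

/-- The set `{S i* S i |_H}` of operators on `H`, where `H` sits in `K` through `V`: an operator
`A` on `H` is the restriction of `B` on `K` if `V A h = B V h` for all `h`. -/
def initialRestrictions {ι H K : Type*}
    [NormedAddCommGroup H] [InnerProductSpace ℂ H]
    [NormedAddCommGroup K] [InnerProductSpace ℂ K] [CompleteSpace K]
    (V : H →ₗᵢ[ℂ] K) (S : ι → K →L[ℂ] K) : Set (H →L[ℂ] H) :=
  {A | ∃ i, ∀ h, V (A h) = (star (S i) * S i) (V h)}

/-!
A stabilizing family `P` turns the index set of `T` into the edge set of a directed graph with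
vertex set `J`: since the `P k` are mutually orthogonal with sum `1`, each nonzero `T i` has one
source `s i`, with `T i P (s i) = T i`, and one range `r i`, with `P (r i) T i = T i`
(`Stabilizes.exists_isGraphOf`). The hypothesis that each `P k` is seen by some `T i` says that `s`
is surjective.

*Uniqueness.* In a minimal dilation with `{S i* S i |_H} = {P k}` the restriction of `S i* S i` to
`H` can only be `P (s i)`. Together with (†) this forces `S i* S j = 0` for `i ≠ j`, and
`S i* S i S j` to be `S j` or `0` according to whether `s i = r j`
(`IsMinimalPartiallyIsometricDilation.isGraphDilation`). As moreover `S i* = T i*` on `H`, the inner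
products of the vectors `S i₁ ⋯ S iₘ h` are determined by `T` and `P`
(`IsGraphDilation.inner_prod_eq`). These vectors span a dense subspace, so two dilations are
intertwined by a unitary that fixes `H`.

*Existence.* Let `C h = ((T i)* h)` be the column contraction from `H` to `ℓ²(ι, H)` and
`D = (1 - C C*)^(1/2)`. On the Fock space `ℓ²(List ι, H)`, with `H` placed at the empty word, the
isometric dilation of `T` without regard to the graph consists of isometries `Z i` that shift the
summand at a nonempty word `w` to the one at `i :: w`, and act on the empty word as the `i`-th
component of the isometry `f ↦ C* f ⊕ D f` from `ℓ²(ι, H)` to the words of length at most one.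
Their ranges are mutually orthogonal. Let `Q k` be `P k` on the summand at the empty word and, on
the summand at `i :: w`, the identity or zero according to whether `r i = k`. Then `S i = Z i Q (s i)`
has initial projection `Q (s i)`, and its range lies under `Q (r i)` because `D` commutes with the
grading of `ℓ²(ι, H)` by `r` (`FockDilation.isAmbientDilation`). Finally, the closed span of the
subspaces `S i₁ ⋯ S iₘ H` reduces all `S i`, and the restrictions to it form a minimal dilation
(`IsAmbientDilation.exists_minimal`).
-/

open scoped InnerProductSpace

/-! ### Projections, partial isometries and row contractions -/

section

variable {ι K : Type*} [NormedAddCommGroup K] [InnerProductSpace ℂ K]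

theorem inner_star_left [CompleteSpace K] (A : K →L[ℂ] K) (x y : K) :
    ⟪star A x, y⟫_ℂ = ⟪x, A y⟫_ℂ :=
  ContinuousLinearMap.adjoint_inner_left A y x

theorem inner_star_right [CompleteSpace K] (A : K →L[ℂ] K) (x y : K) :
    ⟪x, star A y⟫_ℂ = ⟪A x, y⟫_ℂ :=
  ContinuousLinearMap.adjoint_inner_right A x y

theorem inner_mul_star_self_left [CompleteSpace K] (A : K →L[ℂ] K) (x : K) :
    ⟪(A * star A) x, x⟫_ℂ = (‖star A x‖ ^ 2 : ℝ) := by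
  rw [mul_apply_eq_comp, ← inner_star_right, inner_self_eq_norm_sq_to_K]
  norm_cast

/-- Bessel's inequality for mutually orthogonal projections. -/
theorem norm_sum_projection_le [CompleteSpace K] {A : ι → K →L[ℂ] K}
    (hA : ∀ i, IsStarProjection (A i)) (hAA : ∀ i j, i ≠ j → A i * A j = 0)
    (s : Finset ι) (x : K) : ‖∑ i ∈ s, A i x‖ ≤ ‖x‖ := by
  classical
  have hp : IsStarProjection (∑ i ∈ s, A i) := by
    induction s using Finset.induction_on with
    | empty => simp [IsStarProjection.zero]
    | insert a s ha ih =>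
      rw [Finset.sum_insert ha]
      refine (hA a).add ih ?_
      rw [Finset.mul_sum]
      exact Finset.sum_eq_zero fun j hj => hAA a j (by rintro rfl; exact ha hj)
  have h1 : ‖∑ i ∈ s, A i‖ ≤ 1 := hp.norm_le
  simpa using (∑ i ∈ s, A i).le_of_opNorm_le h1 x

/-- The subspace of the vectors `x` with `∑ i, A i x = x`. -/
def projectionSumSubmodule (A : ι → K →L[ℂ] K) : Submodule ℂ K where
  carrier := {x | HasSum (fun i => A i x) x}
  add_mem' hx hy := by simpa using HasSum.add hx hy
  zero_mem' := by simp
  smul_mem' c x hx := by simpa using HasSum.const_smul c hx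

/-- For mutually orthogonal projections the partial sums are uniformly bounded, so that convergence
passes to limits of vectors. -/
theorem isClosed_projectionSumSubmodule [CompleteSpace K] {A : ι → K →L[ℂ] K}
    (hA : ∀ i, IsStarProjection (A i)) (hAA : ∀ i j, i ≠ j → A i * A j = 0) :
    IsClosed (projectionSumSubmodule A : Set K) := by
  refine isClosed_of_closure_subset fun x hx => ?_
  classical
  change HasSum (fun i => A i x) x
  rw [HasSum, SummationFilter.unconditional_filter, Metric.tendsto_atTop]
  intro ε hε
  obtain ⟨y, hy, hxy⟩ := Metric.mem_closure_iff.1 hx (ε / 3) (by positivity)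
  have hy' : HasSum (fun i => A i y) y := hy
  rw [HasSum, SummationFilter.unconditional_filter, Metric.tendsto_atTop] at hy'
  obtain ⟨s, hs⟩ := hy' (ε / 3) (by positivity)
  refine ⟨s, fun t ht => ?_⟩
  have h1 := norm_sum_projection_le hA hAA t (x - y)
  have h2 := hs t ht
  simp only [map_sub, Finset.sum_sub_distrib] at h1
  rw [← dist_eq_norm, ← dist_eq_norm] at h1
  have h3 := dist_triangle4 (∑ i ∈ t, A i x) (∑ i ∈ t, A i y) y x
  rw [dist_comm y x] at h3
  linarith

/-- Operators whose final projections are mutually orthogonal form a row contraction: their final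
projections sum to the projection onto the closed span of the final spaces. -/
theorem isRowContraction_of_orthogonal [CompleteSpace K] {S : ι → K →L[ℂ] K}
    (hS : ∀ i, IsStarProjection (S i * star (S i)))
    (hSS : ∀ i j, i ≠ j → star (S i) * S j = 0) : IsRowContraction S := by
  have hAA : ∀ i j, i ≠ j → (S i * star (S i)) * (S j * star (S j)) = 0 := fun i j hij => by
    rw [mul_assoc, ← mul_assoc (star (S i)), hSS i j hij, zero_mul, mul_zero]
  set N := projectionSumSubmodule (fun i => S i * star (S i)) with hN
  have hNc : IsClosed (N : Set K) := isClosed_projectionSumSubmodule hS hAA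
  have : CompleteSpace N := hNc.completeSpace_coe
  have hmem : ∀ i x, (S i * star (S i)) x ∈ N := fun i x => by
    change HasSum _ _
    have := hasSum_single (f := fun j => (S j * star (S j)) ((S i * star (S i)) x)) i
      (fun j hj => by
        rw [← mul_apply_eq_comp, hAA j i hj, zero_apply])
    rwa [← mul_apply_eq_comp, (hS i).isIdempotentElem.eq] at this
  refine ⟨N.starProjection, fun x => ?_, ?_⟩
  · -- each final projection vanishes on the orthogonal complement of `N`
    have h1 : HasSum (fun i => (S i * star (S i)) (N.starProjection x)) (N.starProjection x) :=
      N.starProjection_apply_mem x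
    convert h1 using 2 with i
    rw [← sub_eq_zero, ← map_sub, ← inner_self_eq_zero (𝕜 := ℂ)]
    set z := x - N.starProjection x
    have h2 : ⟪z, (S i * star (S i)) ((S i * star (S i)) z)⟫_ℂ = 0 :=
      N.inner_left_of_mem_orthogonal (hmem i _) (N.sub_starProjection_mem_orthogonal x)
    rwa [← inner_star_left, (hS i).isSelfAdjoint.star_eq] at h2
  · exact isStarProjection_starProjection.le_one

/-- Bessel's inequality for row contractions: `∑ i, S i (S i)* ≤ 1` bounds the norm of
`x ↦ ((S i)* x)` into `ℓ²`. -/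
theorem IsRowContraction.sum_norm_sq_le [CompleteSpace K] {S : ι → K →L[ℂ] K}
    (hS : IsRowContraction S) (s : Finset ι) (x : K) :
    ∑ i ∈ s, ‖star (S i) x‖ ^ 2 ≤ ‖x‖ ^ 2 := by
  obtain ⟨R, hR, hR1⟩ := hS
  have h1 : HasSum (fun i => ‖star (S i) x‖ ^ 2) (RCLike.re ⟪R x, x⟫_ℂ) := by
    have h := ((innerSL ℂ x).hasSum (hR x)).mapL RCLike.reCLM
    have e : RCLike.re ⟪R x, x⟫_ℂ = RCLike.reCLM (innerSL ℂ x (R x)) :=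
      inner_re_symm (𝕜 := ℂ) (R x) x
    have e' : ∀ i, ‖star (S i) x‖ ^ 2 = RCLike.reCLM (innerSL ℂ x ((S i * star (S i)) x)) :=
      fun i => by
        have h' : RCLike.reCLM (innerSL ℂ x ((S i * star (S i)) x)) =
          RCLike.re ⟪(S i * star (S i)) x, x⟫_ℂ := inner_re_symm (𝕜 := ℂ) x _
        rw [h', inner_mul_star_self_left]
        exact (RCLike.ofReal_re _).symm
    rw [e, funext e']
    exact h
  have h2 : 0 ≤ RCLike.re ⟪(1 - R) x, x⟫_ℂ := by
    have := ((ContinuousLinearMap.le_def _ _).1 hR1).re_inner_nonneg_left x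
    exact this
  have h3 : RCLike.re ⟪x, x⟫_ℂ = ‖x‖ ^ 2 := inner_self_eq_norm_sq x
  simp only [sub_apply, one_apply_eq_self, inner_sub_left,
    map_sub] at h2
  exact (sum_le_hasSum s (fun _ _ => by positivity) h1).trans (by linarith)

/-- The partial isometries of a row contraction have mutually orthogonal ranges: the equality
`‖(S j)* S j y‖ = ‖S j y‖` leaves no room for `(S i)* S j y` in Bessel's inequality. -/
theorem IsRowContraction.star_mul_eq_zero [CompleteSpace K] {S : ι → K →L[ℂ] K}
    (hS : IsRowContraction S) (hpi : ∀ i, IsStarProjection (star (S i) * S i))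
    {i j : ι} (hij : i ≠ j) : star (S i) * S j = 0 := by
  classical
  ext y
  have h1 := hS.sum_norm_sq_le {i, j} (S j y)
  rw [Finset.sum_pair hij] at h1
  have h2 : ‖S j y‖ ^ 2 = ‖(star (S j) * S j) y‖ ^ 2 := by
    have h3 : (⟪S j y, S j y⟫_ℂ) = ⟪(star (S j) * S j) y, (star (S j) * S j) y⟫_ℂ := by
      rw [← inner_star_left (star (S j) * S j), (hpi j).isSelfAdjoint.star_eq,
        ← mul_apply_eq_comp, (hpi j).isIdempotentElem.eq, mul_apply_eq_comp, inner_star_left]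
    rw [inner_self_eq_norm_sq_to_K, inner_self_eq_norm_sq_to_K] at h3
    exact_mod_cast h3
  rw [h2] at h1
  rw [mul_apply_eq_comp] at h1
  have h4 : ‖star (S i) (S j y)‖ ^ 2 ≤ 0 := by linarith
  simpa using h4

/-- An operator whose `A* A` is a projection is a partial isometry, `A A* A = A`, since
`‖A A* A - A‖² = 0` by the C*-identity. -/
theorem mul_initialProjection [CompleteSpace K] {A : K →L[ℂ] K}
    (hA : IsStarProjection (star A * A)) : A * (star A * A) = A := by
  have h : star (A * (star A * A) - A) * (A * (star A * A) - A) = 0 := by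
    have h1 := hA.isIdempotentElem.eq
    have h2 : star (A * (star A * A)) = (star A * A) * star A := by
      rw [star_mul, hA.isSelfAdjoint.star_eq]
    rw [star_sub, h2]
    have : (star A * A * star A - star A) * (A * (star A * A) - A) =
      (star A * A) * (star A * A) * (star A * A) - (star A * A) * (star A * A)
       - ((star A * A) * (star A * A) - (star A * A)) := by noncomm_ring
    rw [this, h1, h1]; simp
  exact sub_eq_zero.1 (CStarRing.star_mul_self_eq_zero_iff _ |>.1 h)

theorem isStarProjection_mul_star_self [CompleteSpace K] {A : K →L[ℂ] K}
    (hA : IsStarProjection (star A * A)) : IsStarProjection (A * star A) :=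
  ⟨by rw [IsIdempotentElem, ← mul_assoc, mul_assoc A, mul_initialProjection hA],
    IsSelfAdjoint.mul_star_self A⟩

/-- Two families with the same Gram matrix and dense spans are intertwined by a unitary. -/
theorem exists_linearIsometryEquiv_of_inner_eq {X K₁ K₂ : Type*}
    [NormedAddCommGroup K₁] [InnerProductSpace ℂ K₁] [CompleteSpace K₁]
    [NormedAddCommGroup K₂] [InnerProductSpace ℂ K₂] [CompleteSpace K₂]
    (a : X → K₁) (b : X → K₂) (h : ∀ x y, ⟪a x, a y⟫_ℂ = ⟪b x, b y⟫_ℂ)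
    (ha : (Submodule.span ℂ (Set.range a)).topologicalClosure = ⊤)
    (hb : (Submodule.span ℂ (Set.range b)).topologicalClosure = ⊤) :
    ∃ U : K₁ ≃ₗᵢ[ℂ] K₂, ∀ x, U (a x) = b x := by
  have hda : DenseRange (Finsupp.linearCombination ℂ a) := by
    rw [← Submodule.dense_iff_topologicalClosure_eq_top] at ha
    rwa [← Finsupp.range_linearCombination] at ha
  have hdb : DenseRange (Finsupp.linearCombination ℂ b) := by
    rw [← Submodule.dense_iff_topologicalClosure_eq_top] at hb
    rwa [← Finsupp.range_linearCombination] at hb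
  have hn : ∀ c : X →₀ ℂ, ‖Finsupp.linearCombination ℂ b (LinearEquiv.refl ℂ _ c)‖ =
      ‖Finsupp.linearCombination ℂ a c‖ := fun c => by
    rw [LinearEquiv.refl_apply]
    have : ⟪Finsupp.linearCombination ℂ b c, Finsupp.linearCombination ℂ b c⟫_ℂ =
        ⟪Finsupp.linearCombination ℂ a c, Finsupp.linearCombination ℂ a c⟫_ℂ := by
      simp only [Finsupp.linearCombination_apply, Finsupp.sum, sum_inner, inner_sum,
        inner_smul_left, inner_smul_right, h]
    rw [inner_self_eq_norm_sq_to_K, inner_self_eq_norm_sq_to_K] at this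
    have h2 : ‖Finsupp.linearCombination ℂ b c‖ ^ 2 = ‖Finsupp.linearCombination ℂ a c‖ ^ 2 := by
      exact_mod_cast this
    exact (pow_left_inj₀ (norm_nonneg _) (norm_nonneg _) two_ne_zero).1 h2
  refine ⟨LinearEquiv.extendOfIsometry (LinearEquiv.refl ℂ (X →₀ ℂ)) _ _ hda hdb hn, fun x => ?_⟩
  have := LinearEquiv.extendOfIsometry_eq (LinearEquiv.refl ℂ (X →₀ ℂ)) _ _ hda hdb hn
    (Finsupp.single x 1)
  simpa using this

end

/-! ### The graph of a stabilized tuple and uniqueness -/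

section

variable {ι J H K : Type*}
  [NormedAddCommGroup H] [InnerProductSpace ℂ H] [CompleteSpace H]
  [NormedAddCommGroup K] [InnerProductSpace ℂ K] [CompleteSpace K]

namespace Stabilizes

variable {P : J → H →L[ℂ] H} {T : ι → H →L[ℂ] H}

/-- Projections that sum to the identity are mutually orthogonal, by the equality case of
Bessel's inequality. -/
theorem mul_eq_zero (hP : Stabilizes P T) {k l : J} (hkl : k ≠ l) : P k * P l = 0 := by
  classical
  have hrow : IsRowContraction P := by
    refine ⟨1, fun x => ?_, le_rfl⟩
    simpa only [(hP.isProj _).isSelfAdjoint.star_eq, (hP.isProj _).isIdempotentElem.eq]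
      using hP.sum_eq x
  have := hrow.star_mul_eq_zero (fun i => by
    rw [(hP.isProj i).isSelfAdjoint.star_eq, (hP.isProj i).isIdempotentElem.eq]
    exact hP.isProj i) hkl
  rwa [(hP.isProj k).isSelfAdjoint.star_eq] at this

theorem exists_source (hP : Stabilizes P T) {i : ι} (hT : T i ≠ 0) : ∃ k, T i * P k = T i := by
  by_contra! h
  refine hT (ContinuousLinearMap.ext fun x => ?_)
  have h1 := (hP.sum_eq x).mapL (T i)
  have h2 : (fun k => T i (P k x)) = fun _ => 0 := funext fun k => by
    rw [← mul_apply_eq_comp, (hP.right k i).resolve_left (h k), zero_apply]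
  rw [h2] at h1
  exact h1.unique hasSum_zero

theorem exists_range (hP : Stabilizes P T) {i : ι} (hT : T i ≠ 0) : ∃ k, P k * T i = T i := by
  by_contra! h
  refine hT (ContinuousLinearMap.ext fun x => ?_)
  have h1 := hP.sum_eq (T i x)
  have h2 : (fun k => P k (T i x)) = fun _ => 0 := funext fun k => by
    rw [← mul_apply_eq_comp, (hP.left k i).resolve_left (h k), zero_apply]
  rw [h2] at h1
  exact h1.unique hasSum_zero

end Stabilizes

/-- The directed graph behind a stabilized tuple: the vertices are the indices `k : J` of
the projections, and each `i : ι` is an edge, with source projection `P (s i)` and range projection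
`P (r i)`. Every vertex is required to be the source of an edge. -/
structure IsGraphOf (P : J → H →L[ℂ] H) (T : ι → H →L[ℂ] H) (s r : ι → J) : Prop where
  isProj : ∀ k, IsStarProjection (P k)
  orth : ∀ {k l}, k ≠ l → P k * P l = 0
  source : ∀ i, T i * P (s i) = T i
  range : ∀ i, P (r i) * T i = T i
  surj : Function.Surjective s

theorem Stabilizes.exists_isGraphOf {P : J → H →L[ℂ] H} {T : ι → H →L[ℂ] H}
    (hP : Stabilizes P T) (hT0 : ∀ i, T i ≠ 0) (hP0 : ∀ k, ∃ i, T i * P k ≠ 0) :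
    ∃ s r, IsGraphOf P T s r := by
  choose s hs using fun i => hP.exists_source (hT0 i)
  choose r hr using fun i => hP.exists_range (hT0 i)
  refine ⟨s, r, hP.isProj, hP.mul_eq_zero, hs, hr, fun k => ?_⟩
  obtain ⟨i, hi⟩ := hP0 k
  refine ⟨i, ?_⟩
  by_contra hne
  rw [← hs i, mul_assoc, hP.mul_eq_zero hne, mul_zero] at hi
  exact hi rfl

theorem IsGraphOf.exists_apply_ne_zero {P : J → H →L[ℂ] H} {T : ι → H →L[ℂ] H} {s r : ι → J}
    (hG : IsGraphOf P T s r) (hT0 : ∀ i, T i ≠ 0) (k : J) : ∃ h, P k h ≠ 0 := by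
  obtain ⟨i, rfl⟩ := hG.surj k
  by_contra! h
  refine hT0 i ?_
  rw [← hG.source i, show P (s i) = 0 from ContinuousLinearMap.ext h, mul_zero]

theorem DaggerRelations.isStarProjection_init {S : ι → K →L[ℂ] K} (hS : DaggerRelations S)
    (i : ι) : IsStarProjection (star (S i) * S i) :=
  ⟨by rw [IsIdempotentElem, ← sq, hS.idem i], IsSelfAdjoint.star_mul_self _⟩

/-- The relations between the `S i` and the copy of `H` in `K` from which all inner products of
vectors `S i₁ ⋯ S iₘ V h` can be computed. -/
structure IsGraphDilation (P : J → H →L[ℂ] H) (T : ι → H →L[ℂ] H) (s r : ι → J)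
    (V : H →ₗᵢ[ℂ] K) (S : ι → K →L[ℂ] K) : Prop where
  init_apply : ∀ i h, (star (S i) * S i) (V h) = V (P (s i) h)
  star_apply : ∀ i h, star (S i) (V h) = V (star (T i) h)
  orth : ∀ {i j}, i ≠ j → star (S i) * S j = 0
  init_mul : ∀ {i j}, s i = r j → (star (S i) * S i) * S j = S j
  init_mul_ne : ∀ {i j}, s i ≠ r j → (star (S i) * S i) * S j = 0

namespace IsMinimalPartiallyIsometricDilation

variable {P : J → H →L[ℂ] H} {T : ι → H →L[ℂ] H} {V : H →ₗᵢ[ℂ] K} {S : ι → K →L[ℂ] K}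
  {s r : ι → J}

/-- The restriction of `S i* S i` to `H` is one of the projections `P k`, and `T i P k = T i`
forces it to be the source projection of `T i`. -/
theorem init_apply (hD : IsMinimalPartiallyIsometricDilation T V S)
    (hrange : Set.range P = initialRestrictions V S) (hG : IsGraphOf P T s r)
    (hT0 : ∀ i, T i ≠ 0) (i : ι) (h : H) :
    (star (S i) * S i) (V h) = V (P (s i) h) := by
  -- the compression of `S i* S i` to `H` is a restriction because `H` reduces `S i* S i`
  let A : H →L[ℂ] H := (ContinuousLinearMap.adjoint V.toContinuousLinearMap) ∘L
    (star (S i) * S i) ∘L V.toContinuousLinearMap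
  have hA : ∀ h, V (A h) = (star (S i) * S i) (V h) := fun h => by
    obtain ⟨y, hy⟩ := (hD.reduces i).1 (V h) ⟨h, rfl⟩
    have hy' : V y = (star (S i) * S i) (V h) := hy
    have : A h = y := by
      change ContinuousLinearMap.adjoint V.toContinuousLinearMap ((star (S i) * S i) (V h)) = y
      rw [← hy']
      refine ext_inner_left ℂ fun z => ?_
      rw [ContinuousLinearMap.adjoint_inner_right]
      exact V.inner_map_map z y
    rw [this, hy']
  obtain ⟨k, hk⟩ : A ∈ Set.range P := hrange ▸ ⟨i, hA⟩
  have h1 : P k * star (T i) = star (T i) := by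
    ext x
    apply V.injective
    rw [mul_apply_eq_comp, hk, hA, ← hD.adjoint_restrict, ← mul_apply_eq_comp]
    have := congrArg star (mul_initialProjection (hD.dagger.isStarProjection_init i))
    rw [star_mul, (hD.dagger.isStarProjection_init i).isSelfAdjoint.star_eq] at this
    rw [this]
  have h2 : k = s i := by
    by_contra hne
    refine hT0 i (star_eq_zero.1 ?_)
    have h3 := congrArg star (hG.source i)
    rw [star_mul, (hG.isProj _).isSelfAdjoint.star_eq] at h3
    rw [← h1, ← h3, ← mul_assoc, hG.orth hne, zero_mul]
  rw [← hA, ← hk, h2]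

/-- The relations (†) determine how the `S i` compose: equal sources give equal initial projections
and different sources orthogonal ones, while `S j S j*` lies under the one with source `r j`. -/
theorem isGraphDilation (hD : IsMinimalPartiallyIsometricDilation T V S)
    (hrange : Set.range P = initialRestrictions V S) (hG : IsGraphOf P T s r)
    (hT0 : ∀ i, T i ≠ 0) : IsGraphDilation P T s r V S := by
  have hI := hD.dagger.isStarProjection_init
  have hinit := hD.init_apply hrange hG hT0
  have hP0 := hG.exists_apply_ne_zero hT0
  -- a common source makes the product of initial projections nonzero on `V H`
  have heq : ∀ {i j}, s i = s j → star (S i) * S i = star (S j) * S j := fun {i j} hij => by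
    refine (hD.dagger.orth_or_eq i j).resolve_left fun h0 => ?_
    obtain ⟨h, hh⟩ := hP0 (s j)
    refine hh ((map_eq_zero_iff V V.injective).1 ?_)
    have := congrArg (fun A => A (V h)) h0
    simp only [mul_apply_eq_comp (star (S i) * S i), hinit, zero_apply, hij] at this
    rwa [← mul_apply_eq_comp (P (s j)), (hG.isProj _).isIdempotentElem.eq] at this
  -- equal initial projections would make two different `P k` agree
  have hne : ∀ {i j}, s i ≠ s j →
      (star (S i) * S i) * (star (S j) * S j) = 0 := fun {i j} hij => by
    refine (hD.dagger.orth_or_eq i j).resolve_right fun h0 => ?_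
    obtain ⟨h, hh⟩ := hP0 (s j)
    refine hh ?_
    have h1 := hinit i h
    rw [h0, hinit j h] at h1
    have h2 := V.injective h1
    rw [← (hG.isProj (s j)).isIdempotentElem.eq, mul_apply_eq_comp, h2, ← mul_apply_eq_comp,
      hG.orth (Ne.symm hij), zero_apply]
  -- the initial projection that dominates `S j S j*` is the one over `r j`
  have hfin : ∀ j, ∃ l, s l = r j ∧ (star (S l) * S l) * S j = S j := fun j => by
    obtain ⟨l, hl⟩ := hD.dagger.final_le j
    have h1 : (star (S l) * S l) * S j = S j := by
      have h2 := ((isStarProjection_mul_star_self (hI j)).le_iff_mul_eq_right (hI l)).1 hl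
      have h3 := congrArg (fun A => A * S j) h2
      simpa only [mul_assoc, mul_initialProjection (hI j)] using h3
    refine ⟨l, ?_, h1⟩
    by_contra hlj
    refine hT0 j (star_eq_zero.1 ?_)
    have h4 : star (S j) * (star (S l) * S l) = star (S j) := by
      simpa [mul_assoc] using congrArg star h1
    have h5 : star (T j) * P (s l) = star (T j) := by
      ext x
      apply V.injective
      rw [mul_apply_eq_comp, ← hD.adjoint_restrict, ← hD.adjoint_restrict, ← hinit,
        ← mul_apply_eq_comp, h4]
    have h6 := congrArg star (hG.range j)
    rw [star_mul, (hG.isProj _).isSelfAdjoint.star_eq] at h6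
    rw [← h5, ← h6, mul_assoc, hG.orth (Ne.symm hlj), mul_zero]
  refine ⟨hinit, hD.adjoint_restrict, fun hij => hD.dagger.row.star_mul_eq_zero hI hij,
    fun {i j} hij => ?_, fun {i j} hij => ?_⟩
  · obtain ⟨l, hl, hlj⟩ := hfin j
    rw [heq (hij.trans hl.symm), hlj]
  · obtain ⟨l, hl, hlj⟩ := hfin j
    rw [← hlj, ← mul_assoc, hne (by rwa [hl]), zero_mul]

end IsMinimalPartiallyIsometricDilation

namespace IsGraphDilation

variable {P : J → H →L[ℂ] H} {T : ι → H →L[ℂ] H} {V : H →ₗᵢ[ℂ] K} {S : ι → K →L[ℂ] K}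
  {s r : ι → J}

theorem inner_apply_prod (hD : IsGraphDilation P T s r V S) (v : List ι) (h k : H) :
    ⟪V h, (v.map S).prod (V k)⟫_ℂ = ⟪h, (v.map T).prod k⟫_ℂ := by
  induction v generalizing h with
  | nil => simp
  | cons j v ih =>
    rw [List.map_cons, List.prod_cons, List.map_cons, List.prod_cons, mul_apply_eq_comp,
      mul_apply_eq_comp, ← inner_star_left, hD.star_apply, ih, inner_star_left]

/-- The Gram matrix of the vectors `S i₁ ⋯ S iₘ V h` depends only on `P`, `T` and the graph. -/
theorem inner_prod_eq {K' : Type*} [NormedAddCommGroup K'] [InnerProductSpace ℂ K']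
    [CompleteSpace K'] {V' : H →ₗᵢ[ℂ] K'} {S' : ι → K' →L[ℂ] K'}
    (hD : IsGraphDilation P T s r V S) (hD' : IsGraphDilation P T s r V' S')
    (w v : List ι) (h k : H) :
    ⟪(w.map S).prod (V h), (v.map S).prod (V k)⟫_ℂ =
      ⟪(w.map S').prod (V' h), (v.map S').prod (V' k)⟫_ℂ := by
  induction w generalizing v k with
  | nil =>
    have h1 := hD.inner_apply_prod v h k
    have h2 := hD'.inner_apply_prod v h k
    simpa using h1.trans h2.symm
  | cons i w ih =>
    cases v with
    | nil =>
      have h1 := hD.inner_apply_prod (i :: w) k h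
      have h2 := hD'.inner_apply_prod (i :: w) k h
      have h3 := congrArg (starRingEnd ℂ) (h1.trans h2.symm)
      rw [inner_conj_symm, inner_conj_symm] at h3
      simpa using h3
    | cons j v =>
      simp only [List.map_cons, List.prod_cons, mul_apply_eq_comp]
      rw [← inner_star_right (S i), ← inner_star_right (S' i), ← mul_apply_eq_comp (star (S i)),
        ← mul_apply_eq_comp (star (S' i))]
      by_cases hij : i = j
      · subst hij
        cases v with
        | nil =>
          have := ih [] (P (s i) k)
          simpa only [List.map_nil, List.prod_nil, one_apply_eq_self, hD.init_apply,
            hD'.init_apply] using this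
        | cons l v =>
          simp only [List.map_cons, List.prod_cons]
          rw [← mul_apply_eq_comp, ← mul_apply_eq_comp, ← mul_assoc, ← mul_assoc]
          by_cases hl : s i = r l
          · rw [hD.init_mul hl, hD'.init_mul hl]
            simpa only [List.map_cons, List.prod_cons] using ih (l :: v) k
          · rw [hD.init_mul_ne hl, hD'.init_mul_ne hl]
            simp
      · rw [hD.orth hij, hD'.orth hij]
        simp

/-- Minimal dilations with the same graph are unitarily equivalent through a unitary
fixing `H`. -/
theorem exists_unitary {K' : Type*} [NormedAddCommGroup K'] [InnerProductSpace ℂ K']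
    [CompleteSpace K'] {V' : H →ₗᵢ[ℂ] K'} {S' : ι → K' →L[ℂ] K'}
    (hD : IsGraphDilation P T s r V S) (hD' : IsGraphDilation P T s r V' S')
    (hm : (Submodule.span ℂ
      {x : K | ∃ (w : List ι) (h : H), x = (w.map S).prod (V h)}).topologicalClosure = ⊤)
    (hm' : (Submodule.span ℂ
      {x : K' | ∃ (w : List ι) (h : H), x = (w.map S').prod (V' h)}).topologicalClosure = ⊤) :
    ∃ U : K ≃ₗᵢ[ℂ] K', (∀ h, U (V h) = V' h) ∧ ∀ i x, U (S i x) = S' i (U x) := by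
  let a : List ι × H → K := fun p => (p.1.map S).prod (V p.2)
  let b : List ι × H → K' := fun p => (p.1.map S').prod (V' p.2)
  have ha : {x : K | ∃ (w : List ι) (h : H), x = (w.map S).prod (V h)} = Set.range a := by
    ext x; simp [a, eq_comm]
  have hb : {x : K' | ∃ (w : List ι) (h : H), x = (w.map S').prod (V' h)} = Set.range b := by
    ext x; simp [b, eq_comm]
  rw [ha] at hm
  rw [hb] at hm'
  obtain ⟨U, hU⟩ := exists_linearIsometryEquiv_of_inner_eq a b
    (fun x y => hD.inner_prod_eq hD' x.1 y.1 x.2 y.2) hm hm'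
  refine ⟨U, fun h => by simpa [a, b] using hU ([], h), fun i x => ?_⟩
  have hd : Dense (Submodule.span ℂ (Set.range a) : Set K) :=
    Submodule.dense_iff_topologicalClosure_eq_top.2 hm
  have key : U.toContinuousLinearEquiv.toContinuousLinearMap ∘L S i =
      S' i ∘L U.toContinuousLinearEquiv.toContinuousLinearMap := by
    refine ContinuousLinearMap.ext_on hd ?_
    rintro _ ⟨⟨w, h⟩, rfl⟩
    have h1 := hU (i :: w, h)
    have h2 := hU (w, h)
    simp only [a, b, List.map_cons, List.prod_cons, mul_apply_eq_comp] at h1 h2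
    change U (S i (a (w, h))) = S' i (U (a (w, h)))
    simp only [a]
    rw [h1, h2]
  exact congrArg (fun A => A x) key

end IsGraphDilation

end

/-! ### Passing to a minimal dilation -/

section

variable {ι J H K : Type*}
  [NormedAddCommGroup H] [InnerProductSpace ℂ H]
  [NormedAddCommGroup K] [InnerProductSpace ℂ K]

/-- The restriction of an operator to an invariant subspace. -/
def restrictTo (M : Submodule ℂ K) (A : K →L[ℂ] K) (hA : ∀ x ∈ M, A x ∈ M) : M →L[ℂ] M :=
  (A ∘L M.subtypeL).codRestrict M fun x => hA x x.2

theorem coe_restrictTo {M : Submodule ℂ K} {A : K →L[ℂ] K} (hA : ∀ x ∈ M, A x ∈ M) (x : M) :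
    (restrictTo M A hA x : K) = A x := rfl

theorem star_restrictTo [CompleteSpace K] {M : Submodule ℂ K} [CompleteSpace M] {A : K →L[ℂ] K}
    (hA : ∀ x ∈ M, A x ∈ M) (hA' : ∀ x ∈ M, star A x ∈ M) :
    star (restrictTo M A hA) = restrictTo M (star A) hA' := by
  refine ContinuousLinearMap.ext fun x => ext_inner_right ℂ fun y => ?_
  rw [inner_star_left, Submodule.coe_inner, Submodule.coe_inner, coe_restrictTo, coe_restrictTo,
    inner_star_left]

theorem apply_mem_topologicalClosure_span {G : Set K} (A : K →L[ℂ] K)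
    (hA : ∀ x ∈ G, A x ∈ (Submodule.span ℂ G).topologicalClosure) :
    ∀ x ∈ (Submodule.span ℂ G).topologicalClosure,
      A x ∈ (Submodule.span ℂ G).topologicalClosure := by
  have h : (Submodule.span ℂ G).topologicalClosure ≤
      (Submodule.span ℂ G).topologicalClosure.comap A.toLinearMap := by
    refine Submodule.topologicalClosure_minimal _ (Submodule.span_le.2 hA) ?_
    exact (Submodule.isClosed_topologicalClosure _).preimage A.continuous
  exact h

/-- The closed span of the subspaces `S i₁ ⋯ S iₘ V H`. -/
def minimalSubmodule (V : H →ₗᵢ[ℂ] K) (S : ι → K →L[ℂ] K) : Submodule ℂ K :=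
  (Submodule.span ℂ {x : K | ∃ (w : List ι) (h : H), x = (w.map S).prod (V h)}).topologicalClosure

instance [CompleteSpace K] {V : H →ₗᵢ[ℂ] K} {S : ι → K →L[ℂ] K} :
    CompleteSpace (minimalSubmodule V S) :=
  (Submodule.isClosed_topologicalClosure _).completeSpace_coe

theorem prod_mem_minimalSubmodule {V : H →ₗᵢ[ℂ] K} {S : ι → K →L[ℂ] K} (w : List ι)
    (h : H) : (w.map S).prod (V h) ∈ minimalSubmodule V S :=
  Submodule.le_topologicalClosure _ (Submodule.subset_span ⟨w, h, rfl⟩)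

theorem apply_mem_minimalSubmodule {V : H →ₗᵢ[ℂ] K} {S : ι → K →L[ℂ] K} (i : ι) :
    ∀ x ∈ minimalSubmodule V S, S i x ∈ minimalSubmodule V S := by
  refine apply_mem_topologicalClosure_span (S i) ?_
  rintro _ ⟨w, h, rfl⟩
  exact prod_mem_minimalSubmodule (i :: w) h

variable [CompleteSpace H] [CompleteSpace K]

/-- Operators `S i` and projections `Q k` on a Hilbert space that contains `H`, satisfying the
relations of a dilation of `T` except for minimality. -/
structure IsAmbientDilation (P : J → H →L[ℂ] H) (T : ι → H →L[ℂ] H) (s r : ι → J)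
    (V : H →ₗᵢ[ℂ] K) (S : ι → K →L[ℂ] K) (Q : J → K →L[ℂ] K) : Prop where
  isProj : ∀ k, IsStarProjection (Q k)
  proj_orth : ∀ {k l}, k ≠ l → Q k * Q l = 0
  init : ∀ i, star (S i) * S i = Q (s i)
  orth : ∀ {i j}, i ≠ j → star (S i) * S j = 0
  range : ∀ i, Q (r i) * S i = S i
  proj_apply : ∀ k h, Q k (V h) = V (P k h)
  star_apply : ∀ i h, star (S i) (V h) = V (star (T i) h)

namespace IsAmbientDilation

variable {P : J → H →L[ℂ] H} {T : ι → H →L[ℂ] H} {V : H →ₗᵢ[ℂ] K} {S : ι → K →L[ℂ] K}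
  {Q : J → K →L[ℂ] K} {s r : ι → J}

theorem proj_mul (hD : IsAmbientDilation P T s r V S Q) (k : J) (j : ι) :
    Q k * S j = S j ∨ Q k * S j = 0 := by
  by_cases hk : k = r j
  · exact .inl (hk ▸ hD.range j)
  · right; rw [← hD.range j, ← mul_assoc, hD.proj_orth hk, zero_mul]

theorem proj_prod_mem (hD : IsAmbientDilation P T s r V S Q) (k : J) (w : List ι) (h : H) :
    Q k ((w.map S).prod (V h)) ∈ minimalSubmodule V S := by
  cases w with
  | nil =>
    rw [List.map_nil, List.prod_nil, one_apply_eq_self, hD.proj_apply]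
    exact prod_mem_minimalSubmodule (S := S) [] (P k h)
  | cons j w =>
    rw [List.map_cons, List.prod_cons, ← mul_apply_eq_comp, ← mul_assoc]
    obtain h1 | h1 := hD.proj_mul k j
    · rw [h1]; exact prod_mem_minimalSubmodule (j :: w) h
    · rw [h1, zero_mul]; exact zero_mem _

theorem proj_mem (hD : IsAmbientDilation P T s r V S Q) :
    ∀ k, ∀ x ∈ minimalSubmodule V S, Q k x ∈ minimalSubmodule V S := fun k => by
  refine apply_mem_topologicalClosure_span (Q k) ?_
  rintro _ ⟨w, h, rfl⟩
  exact hD.proj_prod_mem k w h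

theorem star_mem (hD : IsAmbientDilation P T s r V S Q) :
    ∀ i, ∀ x ∈ minimalSubmodule V S, star (S i) x ∈ minimalSubmodule V S := fun i => by
  refine apply_mem_topologicalClosure_span (star (S i)) ?_
  rintro _ ⟨w, h, rfl⟩
  cases w with
  | nil =>
    rw [List.map_nil, List.prod_nil, one_apply_eq_self, hD.star_apply]
    exact prod_mem_minimalSubmodule (S := S) [] (star (T i) h)
  | cons j w =>
    rw [List.map_cons, List.prod_cons, ← mul_apply_eq_comp, ← mul_assoc]
    by_cases hij : i = j
    · subst hij
      rw [hD.init]; exact hD.proj_prod_mem _ w h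
    · rw [hD.orth hij, zero_mul]; exact zero_mem _

/-- On the closed span of the subspaces `S i₁ ⋯ S iₘ V H` the projections `Q k` sum to the
identity: they do so on `V H`, and each range of an `S i` lies under a single `Q k`. -/
theorem hasSum_proj (hD : IsAmbientDilation P T s r V S Q) (hP : HasStrongSum P 1) :
    ∀ x ∈ minimalSubmodule V S, HasSum (fun k => Q k x) x := by
  have h : minimalSubmodule V S ≤ projectionSumSubmodule Q := by
    refine Submodule.topologicalClosure_minimal _ (Submodule.span_le.2 ?_)
      (isClosed_projectionSumSubmodule hD.isProj fun _ _ => hD.proj_orth)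
    rintro _ ⟨w, h, rfl⟩
    change HasSum _ _
    cases w with
    | nil =>
      simp only [List.map_nil, List.prod_nil, one_apply_eq_self, hD.proj_apply]
      exact (hP h).mapL V.toContinuousLinearMap
    | cons j w =>
      have h0 : ∀ k ≠ r j, Q k (((j :: w).map S).prod (V h)) = 0 := fun k hk => by
        rw [List.map_cons, List.prod_cons, ← mul_apply_eq_comp, ← mul_assoc, ← hD.range j,
          ← mul_assoc, hD.proj_orth hk, zero_mul, zero_mul, zero_apply]
      have h1 : Q (r j) (((j :: w).map S).prod (V h)) = ((j :: w).map S).prod (V h) := by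
        rw [List.map_cons, List.prod_cons, ← mul_apply_eq_comp, ← mul_assoc, hD.range]
      have h2 := hasSum_single (r j) h0
      rwa [h1] at h2
  exact h

/-- Restricting an ambient dilation to the closed span of the subspaces `S i₁ ⋯ S iₘ V H`, which
reduces all `S i`, gives a minimal one. -/
theorem exists_minimal {K : Type u} [NormedAddCommGroup K] [InnerProductSpace ℂ K]
    [CompleteSpace K] {V : H →ₗᵢ[ℂ] K} {S : ι → K →L[ℂ] K} {Q : J → K →L[ℂ] K}
    (hD : IsAmbientDilation P T s r V S Q) (hG : IsGraphOf P T s r)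
    (hT0 : ∀ i, T i ≠ 0) (hP : HasStrongSum P 1) :
    ∃ (K' : Type u) (_ : NormedAddCommGroup K') (_ : InnerProductSpace ℂ K')
        (_ : CompleteSpace K') (V' : H →ₗᵢ[ℂ] K') (S' : ι → K' →L[ℂ] K'),
        IsMinimalPartiallyIsometricDilation T V' S' ∧
        Set.range P = initialRestrictions V' S' := by
  set M := minimalSubmodule V S
  let V' : H →ₗᵢ[ℂ] M :=
    { toFun := fun h => ⟨V h, prod_mem_minimalSubmodule (S := S) [] h⟩
      map_add' := fun x y => Subtype.ext (map_add V x y)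
      map_smul' := fun c x => Subtype.ext (map_smul V c x)
      norm_map' := fun x => V.norm_map x }
  let S' : ι → M →L[ℂ] M := fun i => restrictTo M (S i) (apply_mem_minimalSubmodule i)
  let Q' : J → M →L[ℂ] M := fun k => restrictTo M (Q k) (hD.proj_mem k)
  have hstar : ∀ i, star (S' i) = restrictTo M (star (S i)) (hD.star_mem i) := fun i =>
    star_restrictTo _ _
  have hQstar : ∀ k, star (Q' k) = Q' k := fun k => by
    have h1 : star (Q k) = Q k := (hD.isProj k).isSelfAdjoint.star_eq
    refine (star_restrictTo (hD.proj_mem k) (by rw [h1]; exact hD.proj_mem k)).trans ?_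
    refine ContinuousLinearMap.ext fun x => Subtype.ext ?_
    rw [coe_restrictTo, h1]; rfl
  have hQproj : ∀ k, IsStarProjection (Q' k) := fun k =>
    ⟨ContinuousLinearMap.ext fun x => Subtype.ext
      (congrArg (fun A => A (x : K)) (hD.isProj k).isIdempotentElem.eq), hQstar k⟩
  have hQorth : ∀ {k l}, k ≠ l → Q' k * Q' l = 0 := fun {k l} hkl =>
    ContinuousLinearMap.ext fun x => Subtype.ext
      (congrArg (fun A => A (x : K)) (hD.proj_orth hkl))
  have hinit : ∀ i, star (S' i) * S' i = Q' (s i) := fun i => by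
    rw [hstar]
    exact ContinuousLinearMap.ext fun x => Subtype.ext
      (congrArg (fun A => A (x : K)) (hD.init i))
  have hSorth : ∀ {i j}, i ≠ j → star (S' i) * S' j = 0 := fun {i j} hij => by
    rw [hstar]
    exact ContinuousLinearMap.ext fun x => Subtype.ext
      (congrArg (fun A => A (x : K)) (hD.orth hij))
  have hrange : ∀ i, Q' (r i) * S' i = S' i := fun i =>
    ContinuousLinearMap.ext fun x => Subtype.ext
      (congrArg (fun A => A (x : K)) (hD.range i))
  have hQV : ∀ k h, Q' k (V' h) = V' (P k h) := fun k h => Subtype.ext (hD.proj_apply k h)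
  have hSV : ∀ i h, star (S' i) (V' h) = V' (star (T i) h) := fun i h => by
    rw [hstar]; exact Subtype.ext (hD.star_apply i h)
  have hSproj : ∀ i, IsStarProjection (star (S' i) * S' i) := fun i => hinit i ▸ hQproj _
  have hQsum : ∀ x, HasSum (fun k => Q' k x) x := fun x =>
    (Topology.IsInducing.subtypeVal.hasSum_iff (g := M.subtype) (fun k => Q' k x) x).1
      (hD.hasSum_proj hP x x.2)
  have hP0 := hG.exists_apply_ne_zero hT0
  have hQinj : Function.Injective Q' := fun k l hkl => by
    by_contra hne
    obtain ⟨h, hh⟩ := hP0 k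
    refine hh (V'.injective ?_)
    rw [← hQV, ← (hQproj k).isIdempotentElem.eq]
    nth_rewrite 2 [hkl]
    rw [hQorth hne, zero_apply, map_zero]
  refine ⟨M, inferInstance, inferInstance, inferInstance, V', S', ⟨⟨?_, ?_, ?_, ?_, ?_, ?_⟩,
    ?_, hSV, ?_⟩, ?_⟩
  · intro i h0
    refine hT0 i (star_eq_zero.1 (ContinuousLinearMap.ext fun h => V'.injective ?_))
    have h1 : star (S' i) = 0 := (congrArg star h0).trans (star_zero _)
    rw [← hSV, h1, zero_apply, zero_apply, map_zero]
  · intro i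
    rw [sq, (hSproj i).isIdempotentElem.eq]
  · exact isRowContraction_of_orthogonal (fun i => isStarProjection_mul_star_self (hSproj i))
      fun i j => hSorth
  · intro i j
    rw [hinit, hinit]
    by_cases hij : s i = s j
    · exact .inr (by rw [hij])
    · exact .inl (hQorth hij)
  · intro i
    obtain ⟨j, hj⟩ := hG.surj (r i)
    refine ⟨j, ?_⟩
    rw [hinit, hj, (isStarProjection_mul_star_self (hSproj i)).le_iff_mul_eq_right (hQproj _),
      ← mul_assoc, hrange]
  · -- `k ↦ Q' k` enumerates the initial projections without repetition
    have hr : Set.range (fun i => star (S' i) * S' i) = Set.range Q' := by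
      rw [← hG.surj.range_comp Q']
      exact congrArg Set.range (funext hinit)
    rw [hr]
    intro x
    refine (Equiv.ofInjective Q' hQinj).hasSum_iff.1 ?_
    exact hQsum x
  · intro i
    have h1 : ∀ x ∈ LinearMap.range V'.toLinearMap,
        Q' (s i) x ∈ LinearMap.range V'.toLinearMap := by
      rintro _ ⟨h, rfl⟩
      exact ⟨P (s i) h, (hQV _ _).symm⟩
    rw [hinit]
    exact ⟨h1, by rwa [hQstar]⟩
  · have hcoe : ∀ (w : List ι) h, (((w.map S').prod (V' h) : M) : K) = (w.map S).prod (V h) := by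
      intro w h
      induction w with
      | nil => rfl
      | cons i w ih =>
        rw [List.map_cons, List.prod_cons, List.map_cons, List.prod_cons, mul_apply_eq_comp,
          mul_apply_eq_comp, ← ih]
        rfl
    -- density in the subspace `M` is density in its image in `K`
    rw [← Submodule.dense_iff_topologicalClosure_eq_top]
    intro x
    rw [closure_subtype]
    have hx : (x : K) ∈ minimalSubmodule V S := x.2
    rw [minimalSubmodule, ← SetLike.mem_coe, Submodule.topologicalClosure_coe] at hx
    convert hx using 2
    rw [← Submodule.coe_subtype, ← Submodule.map_coe, Submodule.map_span]
    congr 2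
    ext y
    constructor
    · rintro ⟨_, ⟨w, h, rfl⟩, rfl⟩
      exact ⟨w, h, hcoe w h⟩
    · rintro ⟨w, h, rfl⟩
      exact ⟨_, ⟨w, h, rfl⟩, hcoe w h⟩
  · ext A
    constructor
    · rintro ⟨k, rfl⟩
      obtain ⟨i, rfl⟩ := hG.surj k
      exact ⟨i, fun h => by rw [hinit, hQV]⟩
    · rintro ⟨i, hi⟩
      refine ⟨s i, ContinuousLinearMap.ext fun h => V'.injective ?_⟩
      rw [hi, hinit, hQV]

end IsAmbientDilation

end

/-! ### Operators on `ℓ²(α, H)` and defect operators -/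

section

variable {α E H : Type*} [NormedAddCommGroup H] [InnerProductSpace ℂ H]
  [NormedAddCommGroup E] [InnerProductSpace ℂ E]

/-- The Hilbert space `ℓ²(α, H)`. -/
abbrev Ell2 (α H : Type*) [NormedAddCommGroup H] : Type _ := lp (fun _ : α => H) 2

namespace Ell2

theorem sum_norm_sq_le {H : Type*} [NormedAddCommGroup H] (x : Ell2 α H)
    (t : Finset α) : ∑ a ∈ t, ‖x a‖ ^ 2 ≤ ‖x‖ ^ 2 := by
  have := lp.sum_rpow_le_norm_rpow (p := 2) (by norm_num) x t
  simpa using this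

/-- The contraction `x ↦ (A a x)` into `ℓ²(α, H)`. -/
noncomputable def ofFamily (A : α → E →L[ℂ] H)
    (hA : ∀ x (t : Finset α), ∑ a ∈ t, ‖A a x‖ ^ 2 ≤ ‖x‖ ^ 2) : E →L[ℂ] Ell2 α H :=
  LinearMap.mkContinuous
    { toFun := fun x => ⟨fun a => A a x, memℓp_gen' (C := ‖x‖ ^ 2) (by simpa using hA x)⟩
      map_add' := fun x y => lp.ext (funext fun a => map_add (A a) x y)
      map_smul' := fun c x => lp.ext (funext fun a => map_smul (A a) c x) }
    1 fun x => by
      rw [one_mul]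
      refine lp.norm_le_of_forall_sum_le (by norm_num) (norm_nonneg _) fun t => ?_
      simpa using hA x t

theorem norm_ofFamily_apply_le {A : α → E →L[ℂ] H}
    (hA : ∀ x (t : Finset α), ∑ a ∈ t, ‖A a x‖ ^ 2 ≤ ‖x‖ ^ 2) (x : E) :
    ‖ofFamily A hA x‖ ≤ ‖x‖ := by
  have := (ofFamily A hA).le_of_opNorm_le (LinearMap.mkContinuous_norm_le _ zero_le_one _) x
  simpa using this

/-- The isometric embedding of `H` as the coordinate `a` of `ℓ²(α, H)`. -/
noncomputable def single [DecidableEq α] (a : α) : H →ₗᵢ[ℂ] Ell2 α H where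
  toLinearMap := lp.lsingle (𝕜 := ℂ) (E := fun _ : α => H) 2 a
  norm_map' x := lp.norm_single (E := fun _ : α => H) (by norm_num) a x

theorem single_apply_self [DecidableEq α] (a : α) (h : H) : (single a h : Ell2 α H) a = h :=
  lp.single_apply_self (E := fun _ : α => H) 2 a h

theorem single_apply_ne [DecidableEq α] {a b : α} (hb : b ≠ a) (h : H) :
    (single a h : Ell2 α H) b = 0 :=
  lp.single_apply_ne (E := fun _ : α => H) 2 a h hb

theorem inner_single_left [DecidableEq α] (a : α) (h : H) (x : Ell2 α H) :
    ⟪single a h, x⟫_ℂ = ⟪h, x a⟫_ℂ :=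
  lp.inner_single_left a h x

theorem orthogonalFamily_single [DecidableEq α] :
    OrthogonalFamily ℂ (fun _ : α => H) (fun a => (single a : H →ₗᵢ[ℂ] Ell2 α H)) :=
  fun a b hab v w => by rw [inner_single_left, single_apply_ne hab, inner_zero_right]

theorem clm_ext [DecidableEq α] {A B : Ell2 α H →L[ℂ] E}
    (h : ∀ a x, A (single a x) = B (single a x)) : A = B :=
  lp.ext_continuousLinearMap (by norm_num) fun a => ContinuousLinearMap.ext fun x => h a x

/-- Evaluation at the coordinate `a`. -/
noncomputable def eval (a : α) : Ell2 α H →L[ℂ] H := lp.evalCLM ℂ (fun _ : α => H) 2 a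

variable [CompleteSpace H]

/-- The block diagonal operator on `ℓ²(α, H)` with the projections `q a` as diagonal entries. -/
noncomputable def diagonal (q : α → H →L[ℂ] H) (hq : ∀ a, IsStarProjection (q a)) :
    Ell2 α H →L[ℂ] Ell2 α H :=
  ofFamily (fun a => q a ∘L eval a) fun x t => by
    refine (Finset.sum_le_sum fun a _ => ?_).trans (sum_norm_sq_le x t)
    have h1 : ‖q a (x a)‖ ≤ ‖x a‖ := by
      simpa using (q a).le_of_opNorm_le (hq a).norm_le (x a)
    exact pow_le_pow_left₀ (norm_nonneg _) h1 2

variable {q : α → H →L[ℂ] H}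

theorem diagonal_apply (hq : ∀ a, IsStarProjection (q a)) (x : Ell2 α H) (a : α) :
    diagonal q hq x a = q a (x a) := rfl

theorem diagonal_single [DecidableEq α] (hq : ∀ a, IsStarProjection (q a)) (a : α) (h : H) :
    diagonal q hq (single a h) = single a (q a h) := by
  refine lp.ext (funext fun b => ?_)
  rw [diagonal_apply]
  by_cases hb : b = a
  · subst hb; rw [single_apply_self, single_apply_self]
  · rw [single_apply_ne hb, single_apply_ne hb, map_zero]

theorem isStarProjection_diagonal (hq : ∀ a, IsStarProjection (q a)) :
    IsStarProjection (diagonal q hq) := by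
  constructor
  · refine ContinuousLinearMap.ext fun x => lp.ext (funext fun a => ?_)
    rw [mul_apply_eq_comp, diagonal_apply, diagonal_apply, ← mul_apply_eq_comp,
      (hq a).isIdempotentElem.eq]
  · refine ContinuousLinearMap.ext fun x => ext_inner_right ℂ fun y => ?_
    rw [inner_star_left, lp.inner_eq_tsum, lp.inner_eq_tsum]
    refine tsum_congr fun a => ?_
    rw [diagonal_apply, diagonal_apply, ← inner_star_left, (hq a).isSelfAdjoint.star_eq]

theorem diagonal_mul_eq_zero {q' : α → H →L[ℂ] H} (hq : ∀ a, IsStarProjection (q a))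
    (hq' : ∀ a, IsStarProjection (q' a)) (h : ∀ a, q a * q' a = 0) :
    diagonal q hq * diagonal q' hq' = 0 := by
  refine ContinuousLinearMap.ext fun x => lp.ext (funext fun a => ?_)
  rw [mul_apply_eq_comp, diagonal_apply, diagonal_apply, ← mul_apply_eq_comp, h]
  rfl

end Ell2

theorem OrthogonalFamily.linearIsometry_single [DecidableEq α] [CompleteSpace E]
    {G : α → H →ₗᵢ[ℂ] E} (hG : OrthogonalFamily ℂ (fun _ : α => H) G) (a : α) (h : H) :
    hG.linearIsometry (Ell2.single a h) = G a h :=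
  hG.linearIsometry_apply_single h

theorem OrthogonalFamily.inner_linearIsometry_eq_zero [CompleteSpace E]
    {G : α → H →ₗᵢ[ℂ] E} (hG : OrthogonalFamily ℂ (fun _ : α => H) G) {y : E}
    (hy : ∀ a h, ⟪y, G a h⟫_ℂ = 0) (x : Ell2 α H) : ⟪y, hG.linearIsometry x⟫_ℂ = 0 := by
  have h1 := (hG.hasSum_linearIsometry x).mapL (innerSL ℂ y)
  simp only [innerSL_apply_apply, hy] at h1
  exact h1.unique hasSum_zero

section Defect

open ContinuousLinearMap (adjoint)

variable {F : Type*} [NormedAddCommGroup F] [InnerProductSpace ℂ F] [CompleteSpace F]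
  [CompleteSpace H] {C : H →L[ℂ] F}

/-- The defect operator `(1 - C C*)^(1/2)` of the contraction `C*`. -/
noncomputable def defect (C : H →L[ℂ] F) : F →L[ℂ] F :=
  CFC.sqrt (1 - C ∘L adjoint C)

theorem norm_adjoint_apply_le (hC : ∀ x, ‖C x‖ ≤ ‖x‖) (f : F) : ‖adjoint C f‖ ≤ ‖f‖ := by
  have h1 : ‖adjoint C‖ ≤ 1 := by
    rw [LinearIsometryEquiv.norm_map]
    exact C.opNorm_le_bound zero_le_one fun x => by simpa using hC x
  simpa using (adjoint C).le_of_opNorm_le h1 f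

theorem one_sub_comp_adjoint_nonneg (hC : ∀ x, ‖C x‖ ≤ ‖x‖) :
    0 ≤ (1 - C ∘L adjoint C : F →L[ℂ] F) := by
  rw [ContinuousLinearMap.nonneg_iff_isPositive, ContinuousLinearMap.isPositive_def']
  constructor
  · refine (IsSelfAdjoint.one _).sub ?_
    rw [IsSelfAdjoint, ContinuousLinearMap.star_eq_adjoint, ContinuousLinearMap.adjoint_comp,
      ContinuousLinearMap.adjoint_adjoint]
  · intro f
    have h1 : ⟪(1 - C ∘L adjoint C) f, f⟫_ℂ = ⟪f, f⟫_ℂ - ⟪adjoint C f, adjoint C f⟫_ℂ := by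
      rw [ContinuousLinearMap.adjoint_inner_right, ← inner_sub_left]; rfl
    rw [ContinuousLinearMap.reApplyInnerSelf_apply, h1, map_sub, inner_self_eq_norm_sq,
      inner_self_eq_norm_sq]
    have := pow_le_pow_left₀ (norm_nonneg _) (norm_adjoint_apply_le hC f) 2
    linarith

theorem defect_mul_defect (hC : ∀ x, ‖C x‖ ≤ ‖x‖) :
    defect C * defect C = 1 - C ∘L adjoint C :=
  CFC.sqrt_mul_sqrt_self _ (one_sub_comp_adjoint_nonneg hC)

theorem star_defect (C : H →L[ℂ] F) : star (defect C) = defect C :=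
  (IsSelfAdjoint.of_nonneg (CFC.sqrt_nonneg (1 - C ∘L adjoint C))).star_eq

theorem norm_sq_adjoint_add_defect (hC : ∀ x, ‖C x‖ ≤ ‖x‖) (f : F) :
    ‖adjoint C f‖ ^ 2 + ‖defect C f‖ ^ 2 = ‖f‖ ^ 2 := by
  have h1 : ⟪defect C f, defect C f⟫_ℂ = ⟪f, f⟫_ℂ - ⟪adjoint C f, adjoint C f⟫_ℂ := by
    rw [← inner_star_left, star_defect, ← mul_apply_eq_comp, defect_mul_defect hC,
      ContinuousLinearMap.adjoint_inner_right, ← inner_sub_left]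
    rfl
  have h2 := congrArg RCLike.re h1
  rw [map_sub, inner_self_eq_norm_sq, inner_self_eq_norm_sq, inner_self_eq_norm_sq] at h2
  linarith

theorem adjoint_comp_of_intertwines {R : F →L[ℂ] F} {A : H →L[ℂ] H}
    (hR : star R = R) (hA : star A = A) (h : R ∘L C = C ∘L A) :
    adjoint C ∘L R = A ∘L adjoint C := by
  have := congrArg adjoint h
  rwa [ContinuousLinearMap.adjoint_comp, ContinuousLinearMap.adjoint_comp,
    ← ContinuousLinearMap.star_eq_adjoint R, ← ContinuousLinearMap.star_eq_adjoint A, hR, hA]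
    at this

/-- If `C` intertwines two self-adjoint operators, then the one on its codomain commutes with the
defect operator. -/
theorem commute_defect {R : F →L[ℂ] F} {A : H →L[ℂ] H}
    (hR : star R = R) (hA : star A = A) (h : R ∘L C = C ∘L A) : Commute R (defect C) := by
  have h1 : Commute R (1 - C ∘L adjoint C) := by
    refine (Commute.one_right R).sub_right ?_
    change R ∘L (C ∘L adjoint C) = (C ∘L adjoint C) ∘L R
    rw [← ContinuousLinearMap.comp_assoc, h, ContinuousLinearMap.comp_assoc,
      ContinuousLinearMap.comp_assoc, adjoint_comp_of_intertwines hR hA h]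
  exact (h1.symm.cfcₙ_nnreal NNReal.sqrt).symm

end Defect

end

/-! ### The dilation on the Fock space -/

section

open ContinuousLinearMap (adjoint)

namespace FockDilation

variable {ι J H : Type*} [NormedAddCommGroup H] [InnerProductSpace ℂ H] [CompleteSpace H]
  {T : ι → H →L[ℂ] H}

/-- The column operator `h ↦ ((T i)* h)` of a row contraction. -/
noncomputable def column (hT : IsRowContraction T) : H →L[ℂ] Ell2 ι H :=
  Ell2.ofFamily (fun i => star (T i)) fun x t => hT.sum_norm_sq_le t x

theorem norm_column_apply_le (hT : IsRowContraction T) (h : H) : ‖column hT h‖ ≤ ‖h‖ :=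
  Ell2.norm_ofFamily_apply_le _ h

variable [DecidableEq J] {P : J → H →L[ℂ] H} {s r : ι → J}

/-- The identity or zero, according to whether the edge `i` ends at `k`. -/
noncomputable def edgeProj (H : Type*) [NormedAddCommGroup H] [InnerProductSpace ℂ H]
    (r : ι → J) (k : J) (i : ι) : H →L[ℂ] H :=
  if r i = k then 1 else 0

theorem isStarProjection_edgeProj (k : J) (i : ι) : IsStarProjection (edgeProj H r k i) := by
  unfold edgeProj
  split_ifs
  · exact .one _
  · exact .zero _

/-- The diagonal entry at the word `w` of the projection of `ℓ²(List ι, H)` over the vertex `k`. -/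
noncomputable def wordProj (P : J → H →L[ℂ] H) (r : ι → J) (k : J) : List ι → H →L[ℂ] H
  | [] => P k
  | i :: _ => edgeProj H r k i

theorem isStarProjection_wordProj (hG : IsGraphOf P T s r) (k : J) (w : List ι) :
    IsStarProjection (wordProj P r k w) := by
  cases w with
  | nil => exact hG.isProj k
  | cons i w => exact isStarProjection_edgeProj k i

/-- The projection of `ℓ²(List ι, H)` over the vertex `k`. -/
noncomputable def proj (hG : IsGraphOf P T s r) (k : J) :
    Ell2 (List ι) H →L[ℂ] Ell2 (List ι) H :=
  Ell2.diagonal (wordProj P r k) (isStarProjection_wordProj hG k)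

/-- The projection of `ℓ²(ι, H)` onto the coordinates whose edge ends at `k`. -/
noncomputable def edgeDiagonal (H : Type*) [NormedAddCommGroup H] [InnerProductSpace ℂ H]
    [CompleteSpace H] (r : ι → J) (k : J) : Ell2 ι H →L[ℂ] Ell2 ι H :=
  Ell2.diagonal (edgeProj H r k) (isStarProjection_edgeProj k)

/-- The column operator respects the grading by vertices, since `P k T i` is `T i` or `0` according
to whether `r i = k`. -/
theorem edgeDiagonal_comp_column (hG : IsGraphOf P T s r) (hT : IsRowContraction T) (k : J) :
    edgeDiagonal H r k ∘L column hT = column hT ∘L P k := by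
  refine ContinuousLinearMap.ext fun h => lp.ext (funext fun i => ?_)
  change edgeProj H r k i (star (T i) h) = star (T i) (P k h)
  have h1 : star (T i) * P k = star (P k * T i) := by
    rw [star_mul, (hG.isProj k).isSelfAdjoint.star_eq]
  rw [← mul_apply_eq_comp (star (T i)), h1]
  unfold edgeProj
  split_ifs with hk
  · rw [← hk, hG.range]; rfl
  · rw [← hG.range i, ← mul_assoc, hG.orth (Ne.symm hk), zero_mul, star_zero]; rfl

variable [DecidableEq ι]

theorem proj_single (hG : IsGraphOf P T s r) (k : J) (w : List ι) (h : H) :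
    proj hG k (Ell2.single w h) = Ell2.single w (wordProj P r k w h) :=
  Ell2.diagonal_single _ w h

theorem adjoint_column_single (hT : IsRowContraction T) (i : ι) (h : H) :
    adjoint (column hT) (Ell2.single i h) = T i h := by
  refine ext_inner_right ℂ fun y => ?_
  rw [ContinuousLinearMap.adjoint_inner_left, Ell2.inner_single_left]
  change ⟪h, star (T i) y⟫_ℂ = _
  rw [inner_star_right]

theorem orthogonalFamily_single_singleton {H : Type*} [NormedAddCommGroup H]
    [InnerProductSpace ℂ H] :
    OrthogonalFamily ℂ (fun _ : ι => H)
      (fun i => (Ell2.single [i] : H →ₗᵢ[ℂ] Ell2 (List ι) H)) :=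
  Ell2.orthogonalFamily_single.comp fun _ _ h => List.singleton_injective h

/-- The embedding of `ℓ²(ι, H)` into `ℓ²(List ι, H)` along the words of length one. -/
noncomputable def letters : Ell2 ι H →ₗᵢ[ℂ] Ell2 (List ι) H :=
  (orthogonalFamily_single_singleton (ι := ι) (H := H)).linearIsometry

theorem letters_single (i : ι) (h : H) :
    letters (Ell2.single i h) = (Ell2.single [i] h : Ell2 (List ι) H) :=
  OrthogonalFamily.linearIsometry_single _ i h

theorem letters_apply_ne (f : Ell2 ι H) {w : List ι} (hw : ∀ i, w ≠ [i]) : letters f w = 0 := by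
  have h1 : Ell2.eval w ∘L (letters (ι := ι) (H := H)).toContinuousLinearMap = 0 :=
    Ell2.clm_ext fun i h => by
      change letters (Ell2.single i h) w = 0
      rw [letters_single, Ell2.single_apply_ne (hw i)]
  exact congrArg (fun A => A f) h1

theorem inner_single_letters {w : List ι} (hw : ∀ i, w ≠ [i]) (h : H) (f : Ell2 ι H) :
    ⟪Ell2.single w h, letters f⟫_ℂ = 0 := by
  rw [Ell2.inner_single_left, letters_apply_ne f hw, inner_zero_right]

/-- The isometry `f ↦ C* f ⊕ D f` attached to the column `C` of a row contraction and its defect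
operator `D`. The first summand sits at the empty word, the second at the words of length one. -/
noncomputable def julia (hT : IsRowContraction T) : Ell2 ι H →ₗᵢ[ℂ] Ell2 (List ι) H where
  toLinearMap := (Ell2.single []).toLinearMap ∘ₗ (adjoint (column hT)).toLinearMap +
    letters.toLinearMap ∘ₗ (defect (column hT)).toLinearMap
  norm_map' f := by
    change ‖Ell2.single [] (adjoint (column hT) f) + letters (defect (column hT) f)‖ = ‖f‖
    have h1 := norm_sq_adjoint_add_defect (norm_column_apply_le hT) f
    have h2 := norm_add_sq_eq_norm_sq_add_norm_sq_of_inner_eq_zero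
      (Ell2.single [] (adjoint (column hT) f) : Ell2 (List ι) H) (letters (defect (column hT) f))
      (inner_single_letters (by simp) _ _)
    rw [LinearIsometry.norm_map, LinearIsometry.norm_map] at h2
    refine (pow_left_inj₀ (norm_nonneg _) (norm_nonneg _) two_ne_zero).1 ?_
    rw [← h1, sq, h2, sq, sq]

theorem julia_apply (hT : IsRowContraction T) (f : Ell2 ι H) :
    julia hT f = Ell2.single [] (adjoint (column hT) f) + letters (defect (column hT) f) := rfl

theorem julia_single (hT : IsRowContraction T) (i : ι) (h : H) :
    julia hT (Ell2.single i h) =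
      Ell2.single [] (T i h) + letters (defect (column hT) (Ell2.single i h)) := by
  rw [julia_apply, adjoint_column_single]

theorem inner_single_cons_julia (hT : IsRowContraction T) (i j : ι) (w : List ι) (h : H)
    (f : Ell2 ι H) : ⟪Ell2.single (i :: j :: w) h, julia hT f⟫_ℂ = 0 := by
  rw [julia_apply, inner_add_right, inner_single_letters (by simp), Ell2.inner_single_left,
    Ell2.single_apply_ne (by simp), inner_zero_right, add_zero]

/-- The action of the `i`-th isometry on the summand of `ℓ²(List ι, H)` at the word `w`: the
`i`-th component of `julia` at the empty word, and the shift `w ↦ i :: w` elsewhere. -/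
noncomputable def shiftFamily (hT : IsRowContraction T) :
    ι × List ι → H →ₗᵢ[ℂ] Ell2 (List ι) H
  | (i, []) => (julia hT).comp (Ell2.single i)
  | (i, j :: w) => Ell2.single (i :: j :: w)

theorem orthogonalFamily_shiftFamily (hT : IsRowContraction T) :
    OrthogonalFamily ℂ (fun _ : ι × List ι => H) (shiftFamily hT) := by
  rintro ⟨i, w⟩ ⟨j, v⟩ hne x y
  -- two empty words: `julia` is isometric; one empty word: `julia` only reaches words of length at
  -- most one; two nonempty words: different coordinates
  cases w with
  | nil =>
    cases v with
    | nil =>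
      change ⟪julia hT (Ell2.single i x), julia hT (Ell2.single j y)⟫_ℂ = 0
      rw [LinearIsometry.inner_map_map]
      exact Ell2.orthogonalFamily_single (by rintro rfl; exact hne rfl) x y
    | cons l v =>
      change ⟪julia hT (Ell2.single i x), Ell2.single (j :: l :: v) y⟫_ℂ = 0
      rw [← inner_conj_symm, inner_single_cons_julia, map_zero]
  | cons l w =>
    cases v with
    | nil => exact inner_single_cons_julia hT i l w x _
    | cons l' v =>
      refine Ell2.orthogonalFamily_single (fun h => hne ?_) x y
      rw [List.cons.injEq] at h
      rw [h.1, h.2]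

/-- The isometric dilation of a row contraction, without regard to the graph. -/
noncomputable def shift (hT : IsRowContraction T) (i : ι) :
    Ell2 (List ι) H →ₗᵢ[ℂ] Ell2 (List ι) H :=
  ((orthogonalFamily_shiftFamily hT).comp (Prod.mk_right_injective i)).linearIsometry

theorem shift_single (hT : IsRowContraction T) (i : ι) (w : List ι) (h : H) :
    shift hT i (Ell2.single w h) = shiftFamily hT (i, w) h :=
  OrthogonalFamily.linearIsometry_single _ w h

theorem inner_shift_shift (hT : IsRowContraction T) {i j : ι} (hij : i ≠ j)
    (x y : Ell2 (List ι) H) : ⟪shift hT i x, shift hT j y⟫_ℂ = 0 := by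
  refine OrthogonalFamily.inner_linearIsometry_eq_zero _ (fun w h => ?_) y
  rw [← inner_conj_symm]
  refine (congrArg (starRingEnd ℂ) ?_).trans (map_zero _)
  refine OrthogonalFamily.inner_linearIsometry_eq_zero _ (fun v k => ?_) x
  exact orthogonalFamily_shiftFamily hT (by simp [Ne.symm hij]) h k

theorem proj_letters (hG : IsGraphOf P T s r) (k : J) (f : Ell2 ι H) :
    proj hG k (letters f) = letters (edgeDiagonal H r k f) := by
  have h1 : proj hG k ∘L (letters (ι := ι) (H := H)).toContinuousLinearMap =
      letters.toContinuousLinearMap ∘L edgeDiagonal H r k := Ell2.clm_ext fun i h => by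
    change proj hG k (letters (Ell2.single i h)) = letters (edgeDiagonal H r k (Ell2.single i h))
    rw [letters_single, proj_single, edgeDiagonal, Ell2.diagonal_single, letters_single]
    rfl
  exact congrArg (fun A => A f) h1

/-- The `i`-th component of `julia` takes values over `r i`: the part at the empty word does
because `P (r i) T i = T i`, and the part at the words of length one because the defect operator
commutes with the grading of `ℓ²(ι, H)` by the ends of the edges. -/
theorem proj_julia_single (hG : IsGraphOf P T s r) (hT : IsRowContraction T) (i : ι) (h : H) :
    proj hG (r i) (julia hT (Ell2.single i h)) = julia hT (Ell2.single i h) := by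
  have hR : IsStarProjection (edgeDiagonal H r (r i)) := Ell2.isStarProjection_diagonal _
  have h1 : Commute (edgeDiagonal H r (r i)) (defect (column hT)) :=
    commute_defect hR.isSelfAdjoint.star_eq (hG.isProj (r i)).isSelfAdjoint.star_eq
      (edgeDiagonal_comp_column hG hT (r i))
  rw [julia_single, map_add, proj_single, proj_letters,
    ← mul_apply_eq_comp (edgeDiagonal H r (r i)), h1.eq, mul_apply_eq_comp, edgeDiagonal, Ell2.diagonal_single]
  have h2 : edgeProj H r (r i) i h = h := by simp [edgeProj]
  have h3 : wordProj P r (r i) [] (T i h) = T i h := congrArg (fun A => A h) (hG.range i)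
  rw [h2, h3]

/-- The partially isometric dilation on the full Fock space `ℓ²(List ι, H)`: the isometric
dilation cut down by the source projections. -/
noncomputable def op (hG : IsGraphOf P T s r) (hT : IsRowContraction T) (i : ι) :
    Ell2 (List ι) H →L[ℂ] Ell2 (List ι) H :=
  (shift hT i).toContinuousLinearMap ∘L proj hG (s i)

theorem op_apply (hG : IsGraphOf P T s r) (hT : IsRowContraction T) (i : ι)
    (x : Ell2 (List ι) H) : op hG hT i x = shift hT i (proj hG (s i) x) := rfl

/-- The Fock space operators satisfy all relations of a dilation except for minimality. -/
theorem isAmbientDilation (hG : IsGraphOf P T s r) (hT : IsRowContraction T) :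
    IsAmbientDilation P T s r (Ell2.single []) (op hG hT) (proj hG) := by
  have hproj : ∀ k, IsStarProjection (proj hG k) := fun k => Ell2.isStarProjection_diagonal _
  refine ⟨hproj, fun {k l} hkl => ?_, fun i => ?_, fun {i j} hij => ?_, fun i => ?_,
    fun k h => proj_single hG k [] h, fun i h => ?_⟩
  · refine Ell2.diagonal_mul_eq_zero _ _ fun w => ?_
    cases w with
    | nil => exact hG.orth hkl
    | cons i w =>
      change edgeProj H r k i * edgeProj H r l i = 0
      unfold edgeProj
      split_ifs with h1 h2
      · exact absurd (h1.symm.trans h2) hkl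
      all_goals simp
  · refine ContinuousLinearMap.ext fun x => ext_inner_right ℂ fun y => ?_
    rw [mul_apply_eq_comp, inner_star_left, op_apply, op_apply, LinearIsometry.inner_map_map,
      ← inner_star_left, (hproj _).isSelfAdjoint.star_eq, ← mul_apply_eq_comp,
      (hproj _).isIdempotentElem.eq]
  · refine ContinuousLinearMap.ext fun x => ext_inner_right ℂ fun y => ?_
    rw [mul_apply_eq_comp, inner_star_left, op_apply, op_apply, inner_shift_shift hT hij.symm,
      zero_apply, inner_zero_left]
  · refine Ell2.clm_ext fun w h => ?_
    rw [mul_apply_eq_comp, op_apply, proj_single, shift_single]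
    cases w with
    | nil => exact proj_julia_single hG hT i _
    | cons j w =>
      change proj hG (r i) (Ell2.single (i :: j :: w) _) = Ell2.single (i :: j :: w) _
      rw [proj_single]
      congr 1
      simp [wordProj, edgeProj]
  · -- equivalently, the component of `op i x` at the empty word is `T i` of that of `x`
    have h1 : Ell2.eval [] ∘L op hG hT i = T i ∘L Ell2.eval [] := Ell2.clm_ext fun w y => by
      change op hG hT i (Ell2.single w y) [] = T i ((Ell2.single w y : Ell2 (List ι) H) [])
      rw [op_apply, proj_single, shift_single]
      cases w with
      | nil =>
        change julia hT (Ell2.single i (P (s i) y)) [] = _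
        rw [julia_single, lp.coeFn_add, Pi.add_apply, letters_apply_ne _ (by simp),
          Ell2.single_apply_self, Ell2.single_apply_self, add_zero, ← mul_apply_eq_comp, hG.source]
      | cons j w =>
        change (Ell2.single (i :: j :: w) _ : Ell2 (List ι) H) [] = _
        rw [Ell2.single_apply_ne (by simp), Ell2.single_apply_ne (by simp), map_zero]
    refine ext_inner_right ℂ fun x => ?_
    rw [inner_star_left, Ell2.inner_single_left, Ell2.inner_single_left, inner_star_left]
    exact congrArg (fun A => ⟪h, A x⟫_ℂ) h1

end FockDilation

end

theorem theorem3p2 {ι : Type} [Countable ι] [Nonempty ι] {J : Type} [Countable J]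
    {H : Type u} [NormedAddCommGroup H] [InnerProductSpace ℂ H] [CompleteSpace H]
    (T : ι → H →L[ℂ] H) (hT : IsRowContraction T) (hT0 : ∀ i, T i ≠ 0)
    (P : J → H →L[ℂ] H) (hP : Stabilizes P T) (hP0 : ∀ k, ∃ i, T i * P k ≠ 0) :
    (∃ (K : Type u) (_ : NormedAddCommGroup K) (_ : InnerProductSpace ℂ K)
        (_ : CompleteSpace K) (V : H →ₗᵢ[ℂ] K) (S : ι → K →L[ℂ] K),
        IsMinimalPartiallyIsometricDilation T V S ∧
        Set.range P = initialRestrictions V S) ∧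
    (∀ (K₁ : Type v) [NormedAddCommGroup K₁] [InnerProductSpace ℂ K₁] [CompleteSpace K₁]
        (V₁ : H →ₗᵢ[ℂ] K₁) (S₁ : ι → K₁ →L[ℂ] K₁)
        (K₂ : Type w) [NormedAddCommGroup K₂] [InnerProductSpace ℂ K₂] [CompleteSpace K₂]
        (V₂ : H →ₗᵢ[ℂ] K₂) (S₂ : ι → K₂ →L[ℂ] K₂),
        IsMinimalPartiallyIsometricDilation T V₁ S₁ → Set.range P = initialRestrictions V₁ S₁ →
        IsMinimalPartiallyIsometricDilation T V₂ S₂ → Set.range P = initialRestrictions V₂ S₂ →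
        ∃ U : K₁ ≃ₗᵢ[ℂ] K₂, (∀ h, U (V₁ h) = V₂ h) ∧ ∀ i x, U (S₁ i x) = S₂ i (U x)) := by
  classical
  obtain ⟨s, r, hG⟩ := hP.exists_isGraphOf hT0 hP0
  refine ⟨(FockDilation.isAmbientDilation hG hT).exists_minimal hG hT0 hP.sum_eq, ?_⟩
  intro K₁ _ _ _ V₁ S₁ K₂ _ _ _ V₂ S₂ h₁ hr₁ h₂ hr₂
  exact (h₁.isGraphDilation hr₁ hG hT0).exists_unitary (h₂.isGraphDilation hr₂ hG hT0)
    h₁.minimal h₂.minimal
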